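/- A polytope $P \subseteq \mathbb{R}^n$ is the convex hull of a finite set of points; its dimension is the dimension of its affine hull, and a facet of a $d$-dimensional polytope is a nonempty face of dimension $d-1$. A polytope $P$ is called $2$-level if for every hyperplane $H$ such that $P \cap H$ is a facet of $P$ there is a hyperplane $H'$ parallel to $H$ such that $H \cup H'$ contains all vertices of $P$. Let $f_0(P)$ denote the number of vertices and $f_{d-1}(P)$ the number of facets of a $d$-dimensional polytope $P$. Theorem. Every $d$-dimensional $2$-level polytope $P$ satisfies \[ f_0(P)\, f_{d-1}(P) \le d\, 2^{d+1}. \] This bound is tight for every $d$: the cube $[0,1]^d$ is a $d$-dimensional $2$-level polytope with $f_0([0,1]^d)\, f_{d-1}([0,1]^d) = d\,2^{d+1}$. -/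

import Mathlib

namespace TwoLevel

section

variable {E : Type*} [NormedAddCommGroup E] [NormedSpace ℝ E]

/-- A (convex) polytope: the convex hull of a finite set of points. -/
def IsPolytope (P : Set E) : Prop :=
  ∃ s : Finset E, P = convexHull ℝ (s : Set E)

/-- The set `S` is nonempty and its affine hull has dimension `k`. -/
def HasDim (S : Set E) (k : ℕ) : Prop :=
  S.Nonempty ∧ Module.finrank ℝ (vectorSpan ℝ S) = k

/-- The set of vertices of `P`. -/
def vertices (P : Set E) : Set E :=
  P.extremePoints ℝ

/-- `F` is a facet of `P`: a nonempty (exposed) face whose dimension is one less than that of `P`.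
In particular a one-point polytope has no facets. -/
def IsFacet (P F : Set E) : Prop :=
  IsExposed ℝ P F ∧ ∃ k : ℕ, HasDim P (k + 1) ∧ HasDim F k

/-- The set of facets of `P`. -/
def facets (P : Set E) : Set (Set E) :=
  {F | IsFacet P F}

/-- `P` is 2-level: for every hyperplane `H = {x | l x = c}` that defines a facet `P ∩ H` of `P`,
there is a parallel hyperplane `H' = {x | l x = c'}` such that `H ∪ H'` contains all vertices. -/
def IsTwoLevel (P : Set E) : Prop :=
  ∀ (l : StrongDual ℝ E) (c : ℝ), l ≠ 0 → IsFacet P (P ∩ {x | l x = c}) →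
    ∃ c' : ℝ, vertices P ⊆ {x | l x = c} ∪ {x | l x = c'}

end

/-- The cube `[0,1]^d`. -/
def cube (d : ℕ) : Set (EuclideanSpace ℝ (Fin d)) :=
  {x | ∀ i, x i ∈ Set.Icc (0 : ℝ) 1}

end TwoLevel

namespace TwoLevel

open Module

/-! ### Facet functionals of finite point sets, and binary codes -/

section LinearAlgebra

universe u

variable {V : Type u} [AddCommGroup V] [Module ℝ V]

/-! The core is a statement about binary products, `card_mul_card_le_of_binary`: an affinely
spanning set `A` and a spanning set `B` of functionals with all values `b a` in `{0, 1}` satisfy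
`|A| |B| ≤ (d + 1) 2 ^ d`. It goes by induction on the dimension. Some facet of the hull of `A`
holds at least half of `A` (`exists_isFacetFunctional_half`); put one of its points at the origin,
flipping signs in `B`, and let `c` define the facet. Restricting `B` to `ker c`, the induction
hypothesis bounds the facet points times the distinct restrictions. Functionals that collide under
restriction differ by a fixed multiple of `c` and vanish off the facet at the lower one; this
orthogonality makes the remaining product small (`two_mul_card_mul_card_le`).

For a 2-level polytope of dimension `d + 1`, normalise each facet functional to take two consecutive
values on the vertices, and again choose a facet with at least half of them. On its hyperplane the
binary bound applies in dimension `d`. One factor 2 is lost for the vertices; another for the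
facets, since a restriction together with one bit determines a facet (`card_mul_card_facetSets_le`).
This gives `4 (d + 1) 2 ^ d`.

For the cube only lower bounds on the two counts are needed, the upper bound being the theorem
itself. -/

theorem vectorSpan_le_ker_iff {S : Set V} {f : Dual ℝ V} :
    vectorSpan ℝ S ≤ LinearMap.ker f ↔ ∀ x ∈ S, ∀ y ∈ S, f x = f y := by
  rw [vectorSpan_def, Submodule.span_le]
  constructor
  · intro h x hx y hy
    have := h (Set.vsub_mem_vsub hx hy)
    simpa [sub_eq_zero] using this
  · rintro h _ ⟨x, hx, y, hy, rfl⟩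
    simpa [sub_eq_zero] using h x hx y hy

theorem eq_zero_of_forall_eq {S : Set V} (hS : vectorSpan ℝ S = ⊤) {f : Dual ℝ V} {y : V}
    (h : ∀ x ∈ S, f x = f y) : f = 0 := by
  have : vectorSpan ℝ S ≤ LinearMap.ker f :=
    vectorSpan_le_ker_iff.2 fun x hx z hz => (h x hx).trans (h z hz).symm
  rw [hS, top_le_iff] at this
  exact LinearMap.ker_eq_top.1 this

theorem exists_eq_smul_of_ker_le {f g : Dual ℝ V} (h : LinearMap.ker f ≤ LinearMap.ker g) :
    ∃ t : ℝ, g = t • f := by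
  by_cases hf : f = 0
  · refine ⟨0, ?_⟩
    subst hf
    ext x
    simpa using h (x := x) (by simp)
  · obtain ⟨v, hv⟩ : ∃ v, f v ≠ 0 := by
      by_contra! hcon
      exact hf (LinearMap.ext hcon)
    refine ⟨g v / f v, ?_⟩
    ext x
    have : x - (f x / f v) • v ∈ LinearMap.ker f := by
      simp [hv]
    have := h this
    simp only [LinearMap.mem_ker, map_sub, map_smul, smul_eq_mul, sub_eq_zero] at this
    simp only [LinearMap.smul_apply, smul_eq_mul, this]
    field_simp

/-- `c` attains its minimum on `A` at `a₁`, and the points of `A` where it does span a hyperplane. -/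
def IsFacetFunctional (A : Finset V) (c : Dual ℝ V) (a₁ : V) : Prop :=
  a₁ ∈ A ∧ c ≠ 0 ∧ (∀ a ∈ A, c a₁ ≤ c a) ∧
    vectorSpan ℝ {a ∈ (A : Set V) | c a = c a₁} = LinearMap.ker c

/-- If the face minimising `c` does not span a hyperplane, `c` can be tilted about it in two
opposite directions until a new point joins the face. A positive multiple of `c` is the sum of the
two tilted functionals, so induction on the number of points off the face applies. -/
theorem mem_span_isFacetFunctional {A : Finset V} (hA : vectorSpan ℝ (A : Set V) = ⊤) {a₁ : V}
    (ha₁ : a₁ ∈ A) (c : Dual ℝ V) (hc : ∀ a ∈ A, c a₁ ≤ c a) :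
    c ∈ Submodule.span ℝ
      {f | IsFacetFunctional A f a₁ ∧ ∀ a ∈ A, c a = c a₁ → f a = f a₁} := by
  classical
  induction hn : (A.filter fun a => c a ≠ c a₁).card using Nat.strong_induction_on generalizing c with
  | _ n ih =>
  by_cases hc0 : c = 0
  · rw [hc0]; exact zero_mem _
  set U := vectorSpan ℝ {a ∈ (A : Set V) | c a = c a₁} with hU
  have hUle : U ≤ LinearMap.ker c :=
    vectorSpan_le_ker_iff.2 fun x hx y hy => hx.2.trans hy.2.symm
  by_cases hker : U = LinearMap.ker c
  · exact Submodule.subset_span ⟨⟨ha₁, hc0, hc, hker⟩, fun a _ h => h⟩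
  obtain ⟨v, hv, hvU⟩ := SetLike.exists_of_lt (lt_of_le_of_ne hUle hker)
  obtain ⟨g, hgv, hgU⟩ := Submodule.exists_le_ker_of_notMem hvU
  have hg : ∀ a ∈ A, c a = c a₁ → g a = g a₁ := fun a ha h =>
    vectorSpan_le_ker_iff.1 hgU a ⟨ha, h⟩ a₁ ⟨ha₁, rfl⟩
  set N := A.filter fun a => c a ≠ c a₁ with hN
  have hNne : N.Nonempty := by
    by_contra hemp
    rw [Finset.not_nonempty_iff_eq_empty, hN, Finset.filter_eq_empty_iff] at hemp
    exact hc0 (eq_zero_of_forall_eq hA (y := a₁) fun x hx => by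
      simpa using hemp (x := x) hx)
  have hpos : ∀ a ∈ N, 0 < c a - c a₁ := fun a ha => by
    have h := Finset.mem_filter.1 ha
    exact sub_pos.2 (lt_of_le_of_ne (hc a h.1) (Ne.symm h.2))
  -- The extreme ratios are the critical tilts: `g - r p • c` and `r q • c - g` are still minimal at
  -- `a₁`, and become tight at `p` and `q` respectively.
  set r : V → ℝ := fun a => (g a - g a₁) / (c a - c a₁) with hr
  obtain ⟨p, hpN, hp⟩ := N.exists_min_image r hNne
  obtain ⟨q, hqN, hq⟩ := N.exists_max_image r hNne
  have key : ∀ f : Dual ℝ V, (∀ a ∈ A, f a₁ ≤ f a) → (∀ a ∈ A, c a = c a₁ → f a = f a₁) →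
      (∃ a ∈ N, f a = f a₁) → f ∈ Submodule.span ℝ
      {f | IsFacetFunctional A f a₁ ∧ ∀ a ∈ A, c a = c a₁ → f a = f a₁} := by
    rintro f hf hfz ⟨b, hbN, hb⟩
    have hlt : (A.filter fun a => f a ≠ f a₁).card < n := by
      rw [← hn]
      refine Finset.card_lt_card (Finset.ssubset_iff_of_subset ?_ |>.2 ⟨b, hbN, ?_⟩)
      · intro a ha
        rw [Finset.mem_filter] at ha ⊢
        exact ⟨ha.1, fun h => ha.2 (hfz a ha.1 h)⟩
      · simp [hb]
    refine Submodule.span_mono ?_ (ih _ hlt f hf rfl)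
    rintro h ⟨h1, h2⟩
    exact ⟨h1, fun a ha hca => h2 a ha (hfz a ha hca)⟩
  have hdich : ∀ a ∈ A, c a = c a₁ ∨ a ∈ N := fun a ha => by
    by_cases h : c a = c a₁
    · exact .inl h
    · exact .inr (Finset.mem_filter.2 ⟨ha, h⟩)
  have hratio : ∀ a ∈ N, g a - g a₁ = r a * (c a - c a₁) := fun a ha => by
    rw [hr]; field_simp [(hpos a ha).ne']
  have hf₁nn : ∀ a ∈ A, (g - r p • c) a₁ ≤ (g - r p • c) a := fun a ha => by
    simp only [LinearMap.sub_apply, LinearMap.smul_apply, smul_eq_mul]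
    rcases hdich a ha with h | h
    · rw [h, hg a ha h]
    · nlinarith [hratio a h, hp a h, hpos a h]
  have hf₂nn : ∀ a ∈ A, (r q • c - g) a₁ ≤ (r q • c - g) a := fun a ha => by
    simp only [LinearMap.sub_apply, LinearMap.smul_apply, smul_eq_mul]
    rcases hdich a ha with h | h
    · rw [h, hg a ha h]
    · nlinarith [hratio a h, hq a h, hpos a h]
  have hf₁ := key (g - r p • c) hf₁nn (fun a ha h => by simp [h, hg a ha h])
    ⟨p, hpN, by
      simp only [LinearMap.sub_apply, LinearMap.smul_apply, smul_eq_mul]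
      linarith [hratio p hpN]⟩
  have hf₂ := key (r q • c - g) hf₂nn (fun a ha h => by simp [h, hg a ha h])
    ⟨q, hqN, by
      simp only [LinearMap.sub_apply, LinearMap.smul_apply, smul_eq_mul]
      linarith [hratio q hqN]⟩
  have hsum := Submodule.add_mem _ hf₁ hf₂
  have hsum' : (g - r p • c) + (r q • c - g) = (r q - r p) • c := by
    ext x
    simp only [LinearMap.add_apply, LinearMap.sub_apply, LinearMap.smul_apply, smul_eq_mul]
    ring
  rw [hsum'] at hsum
  -- Equal extremes would make `g` a multiple of `c`, but `c v = 0` and `g v ≠ 0`.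
  by_cases hrr : r q - r p = 0
  · exfalso
    have hz : g - r p • c = 0 := by
      refine eq_zero_of_forall_eq hA (y := a₁) fun a ha => le_antisymm ?_ (hf₁nn a ha)
      have := hf₂nn a ha
      rw [sub_eq_zero.1 hrr] at this
      simp only [LinearMap.sub_apply, LinearMap.smul_apply, smul_eq_mul] at this ⊢
      linarith
    have := congrArg (fun f : Dual ℝ V => f v) hz
    simp only [LinearMap.sub_apply, LinearMap.smul_apply, smul_eq_mul, LinearMap.zero_apply,
      LinearMap.mem_ker.1 hv, mul_zero, sub_zero] at this
    exact hgv this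
  · exact (Submodule.smul_mem_iff _ hrr).1 hsum

theorem exists_isFacetFunctional {A : Finset V} (hA : vectorSpan ℝ (A : Set V) = ⊤) {a₁ : V}
    (ha₁ : a₁ ∈ A) {c : Dual ℝ V} (hc0 : c ≠ 0) (hc : ∀ a ∈ A, c a₁ ≤ c a) :
    ∃ f, IsFacetFunctional A f a₁ ∧ ∀ a ∈ A, c a = c a₁ → f a = f a₁ := by
  by_contra! hcon
  have h := mem_span_isFacetFunctional hA ha₁ c hc
  have hemp : {f | IsFacetFunctional A f a₁ ∧ ∀ a ∈ A, c a = c a₁ → f a = f a₁} = ∅ := by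
    ext f
    simp only [Set.mem_ofPred_eq, Set.mem_empty_iff_false, iff_false, not_and, not_forall]
    intro hf
    obtain ⟨a, ha, h1, h2⟩ := hcon f hf
    exact ⟨a, ha, h1, h2⟩
  rw [hemp, Submodule.span_empty, Submodule.mem_bot] at h
  exact hc0 h

/-- If `c` takes at most two values on `A`, some facet contains at least half of the points. -/
theorem exists_isFacetFunctional_half {A : Finset V} (hA : vectorSpan ℝ (A : Set V) = ⊤)
    {c : Dual ℝ V} (hc0 : c ≠ 0) {m m' : ℝ} (hAne : A.Nonempty)
    (hm : ∀ a ∈ A, c a = m ∨ c a = m') :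
    ∃ f a₁, IsFacetFunctional A f a₁ ∧ A.card ≤ 2 * {a ∈ A | f a = f a₁}.card := by
  classical
  have main : ∀ (c : Dual ℝ V) (m m' : ℝ), c ≠ 0 → (∀ a ∈ A, c a = m ∨ c a = m') → m ≤ m' →
      A.card ≤ 2 * {a ∈ A | c a = m}.card →
      ∃ f a₁, IsFacetFunctional A f a₁ ∧ A.card ≤ 2 * {a ∈ A | f a = f a₁}.card := by
    intro c m m' hc0 hm hle hcard
    have hpos : 0 < {a ∈ A | c a = m}.card := by
      have := hAne.card_pos
      omega
    obtain ⟨a₁, ha₁⟩ := Finset.card_pos.1 hpos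
    rw [Finset.mem_filter] at ha₁
    obtain ⟨f, hf, hfz⟩ := exists_isFacetFunctional hA ha₁.1 hc0 fun a ha => by
      rcases hm a ha with h | h <;> rw [h, ha₁.2]
      exact hle
    refine ⟨f, a₁, hf, hcard.trans (Nat.mul_le_mul_left _ (Finset.card_le_card fun a ha => ?_))⟩
    rw [Finset.mem_filter] at ha ⊢
    exact ⟨ha.1, hfz a ha.1 (ha.2.trans ha₁.2.symm)⟩
  have hcover : A.card ≤ {a ∈ A | c a = m}.card + {a ∈ A | c a = m'}.card := by
    refine (Finset.card_le_card fun a ha => ?_).trans (Finset.card_union_le _ _)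
    simpa [ha] using hm a ha
  have hneg : ∀ k : ℝ, {a ∈ A | (-c) a = -k} = {a ∈ A | c a = k} := fun k => by
    simp
  have hc0' : -c ≠ 0 := neg_ne_zero.2 hc0
  -- The more populated level has to be the minimum of the functional; when it is the upper level,
  -- `-c` is used.
  rcases le_total m m' with hle | hle <;>
    rcases le_total {a ∈ A | c a = m}.card {a ∈ A | c a = m'}.card with h | h
  · exact main (-c) (-m') (-m) hc0' (fun a ha => by simpa using (hm a ha).symm) (by linarith)
      (by rw [hneg]; omega)
  · exact main c m m' hc0 hm hle (by omega)
  · exact main c m' m hc0 (fun a ha => (hm a ha).symm) hle (by omega)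
  · exact main (-c) (-m) (-m') hc0' (fun a ha => by simpa using (hm a ha)) (by linarith)
      (by rw [hneg]; omega)

theorem span_image_domRestrict_eq_top {T : Set (Dual ℝ V)} (hT : Submodule.span ℝ T = ⊤)
    (W : Submodule ℝ V) : Submodule.span ℝ ((fun f : Dual ℝ V => f.domRestrict W) '' T) = ⊤ := by
  have : (fun f : Dual ℝ V => f.domRestrict W) = W.dualRestrict := rfl
  rw [this, Submodule.span_image, hT, Submodule.map_top, LinearMap.range_eq_top]
  exact Subspace.dualRestrict_surjective

variable [FiniteDimensional ℝ V]

/-- A finite set on which each functional of a spanning family takes at most two values has at most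
`2 ^ k` elements, where `k` is the dimension of its span. -/
theorem card_le_two_pow_finrank_span {S : Finset V} {T : Set (Dual ℝ V)}
    (hT : Submodule.span ℝ T = ⊤) (h : ∀ t ∈ T, ∃ u w : ℝ, ∀ s ∈ S, t s = u ∨ t s = w) :
    S.card ≤ 2 ^ finrank ℝ (Submodule.span ℝ (S : Set V)) := by
  classical
  set U := Submodule.span ℝ (S : Set V) with hU
  -- The restrictions to `U` contain a basis of its dual, so a point of `S` is determined by
  -- `finrank ℝ U` bits.
  obtain ⟨b, hbT, hbspan, hbli⟩ :=
    exists_linearIndependent ℝ ((fun f : Dual ℝ V => f.domRestrict U) '' T)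
  rw [span_image_domRestrict_eq_top hT U] at hbspan
  have hbfin : b.Finite := hbli.setFinite
  have := hbfin.fintype
  have hbcard : Fintype.card b = finrank ℝ U := by
    rw [← Subspace.dual_finrank_eq, ← finrank_top ℝ (Dual ℝ U), ← hbspan,
      finrank_span_set_eq_card hbli, Set.toFinset_card]
  have hbv : ∀ t : b, ∃ u w : ℝ, ∀ s : U, (s : V) ∈ S → t.1 s = u ∨ t.1 s = w := by
    rintro ⟨t, ht⟩
    obtain ⟨f, hf, rfl⟩ := hbT ht
    obtain ⟨u, w, huw⟩ := h f hf
    exact ⟨u, w, fun s hs => huw s hs⟩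
  choose u w huw using hbv
  let emb : S → U := fun s => ⟨s, Submodule.subset_span s.2⟩
  have hinj : Function.Injective fun (s : S) (t : b) => decide (t.1 (emb s) = u t) := by
    intro s s' hss
    have heq : ∀ t ∈ b, t (emb s) = t (emb s') := by
      intro t ht
      have h1 := congrFun hss ⟨t, ht⟩
      simp only [decide_eq_decide] at h1
      rcases huw ⟨t, ht⟩ (emb s) s.2 with h2 | h2 <;>
        rcases huw ⟨t, ht⟩ (emb s') s'.2 with h3 | h3
      · exact h2.trans h3.symm
      · exact h2.trans (h1.1 h2).symm
      · exact (h1.2 h3).trans h3.symm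
      · exact h2.trans h3.symm
    have hall : ∀ f : Dual ℝ U, f (emb s - emb s') = 0 := by
      intro f
      have hf : f ∈ Submodule.span ℝ b := hbspan ▸ Submodule.mem_top
      have hle : Submodule.span ℝ b ≤ LinearMap.ker (Dual.eval ℝ U (emb s - emb s')) := by
        rw [Submodule.span_le]
        intro t ht
        simp [heq t ht]
      exact hle hf
    have := (forall_dual_apply_eq_zero_iff ℝ _).1 hall
    have hemb : emb s = emb s' := sub_eq_zero.1 this
    exact Subtype.ext (congrArg (fun x : U => (x : V)) hemb)
  have := Fintype.card_le_of_injective _ hinj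
  simpa [hbcard] using this

end LinearAlgebra

/-! ### Binary products: the orthogonality and restriction bounds -/

section BinaryProducts

universe u

variable {V : Type u} [AddCommGroup V] [Module ℝ V]

theorem vectorSpan_image_sub (S : Set V) (v : V) :
    vectorSpan ℝ ((fun x => x - v) '' S) = vectorSpan ℝ S := by
  rw [vectorSpan_def, vectorSpan_def]
  congr 1
  ext x
  simp [Set.mem_vsub]

theorem span_eq_vectorSpan_of_zero_mem {S : Set V} (h : (0 : V) ∈ S) :
    Submodule.span ℝ S = vectorSpan ℝ S := by
  rw [vectorSpan_eq_span_vsub_set_right ℝ h]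
  simp

variable [FiniteDimensional ℝ V]

/-- Both `B₂` and its translate by `c` are constant on `A₁`, so they annihilate the differences `A₁
- a₁`. The two spans thus have dimensions adding up to at most `finrank ℝ V`, and each set has at
most `2` to the dimension of its span many elements. The factor 2 counts `B₂` and its translate,
disjoint because they take different values at `a₁`. -/
theorem two_mul_card_mul_card_le {A₁ A : Finset V} {B B₂ : Finset (Dual ℝ V)} {c : Dual ℝ V}
    (hA : Submodule.span ℝ (A : Set V) = ⊤) (hB : Submodule.span ℝ (B : Set (Dual ℝ V)) = ⊤)
    (hAB : ∀ a ∈ A, ∀ b ∈ B, b a = 0 ∨ b a = 1) (hA₁A : A₁ ⊆ A) (hA₁ : A₁.Nonempty)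
    (hB₂B : B₂ ⊆ B) (hB₂c : ∀ b ∈ B₂, b + c ∈ B) (hc : ∀ a ∈ A₁, c a = 1)
    (hort : ∀ a ∈ A₁, ∀ b ∈ B₂, b a = 0) :
    2 * (A₁.card * B₂.card) ≤ 2 ^ finrank ℝ V := by
  classical
  obtain ⟨a₁, ha₁⟩ := hA₁
  set S₁ := A₁.image fun a => a - a₁ with hS₁
  set S₂ := B₂ ∪ B₂.image (fun b => b + c) with hS₂
  have hS₁c : S₁.card = A₁.card := Finset.card_image_of_injective _ sub_left_injective
  have hS₂c : S₂.card = 2 * B₂.card := by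
    rw [hS₂, Finset.card_union_of_disjoint, Finset.card_image_of_injective _ (add_left_injective c),
      two_mul]
    rw [Finset.disjoint_left]
    intro b hb hb'
    obtain ⟨b', hb'', rfl⟩ := Finset.mem_image.1 hb'
    have h1 := hort a₁ ha₁ _ hb
    have h2 := hort a₁ ha₁ _ hb''
    rw [LinearMap.add_apply, h2, hc a₁ ha₁] at h1
    norm_num at h1
  have hS₂B : ∀ b ∈ S₂, b ∈ B := by
    intro b hb
    rcases Finset.mem_union.1 hb with hb | hb
    · exact hB₂B hb
    · obtain ⟨b', hb', rfl⟩ := Finset.mem_image.1 hb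
      exact hB₂c b' hb'
  have h1 : S₁.card ≤ 2 ^ finrank ℝ (Submodule.span ℝ (S₁ : Set V)) := by
    refine card_le_two_pow_finrank_span hB fun b hb => ⟨0 - b a₁, 1 - b a₁, fun s hs => ?_⟩
    obtain ⟨a, ha, rfl⟩ := Finset.mem_image.1 hs
    rcases hAB a (hA₁A ha) b hb with h | h <;> simp [h]
  have h2 : S₂.card ≤ 2 ^ finrank ℝ (Submodule.span ℝ (S₂ : Set (Dual ℝ V))) := by
    refine card_le_two_pow_finrank_span (T := Dual.eval ℝ V '' A) ?_ ?_
    · rw [Submodule.span_image, hA, Submodule.map_top, LinearMap.range_eq_top]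
      exact (evalEquiv ℝ V).surjective
    · rintro _ ⟨a, ha, rfl⟩
      exact ⟨0, 1, fun b hb => hAB a ha b (hS₂B b hb)⟩
  have hann : Submodule.span ℝ (S₂ : Set (Dual ℝ V)) ≤
      (Submodule.span ℝ (S₁ : Set V)).dualAnnihilator := by
    rw [Submodule.span_le]
    intro b hb
    rw [SetLike.mem_coe, Submodule.mem_dualAnnihilator]
    suffices Submodule.span ℝ (S₁ : Set V) ≤ LinearMap.ker b from fun w hw => this hw
    rw [Submodule.span_le]
    intro x hx
    obtain ⟨a, ha, rfl⟩ := Finset.mem_image.1 hx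
    rcases Finset.mem_union.1 hb with hb | hb
    · simp [hort a ha b hb, hort a₁ ha₁ b hb]
    · obtain ⟨b', hb', rfl⟩ := Finset.mem_image.1 hb
      simp [hort a ha b' hb', hort a₁ ha₁ b' hb', hc a ha, hc a₁ ha₁]
  have hdim := Submodule.finrank_mono hann
  have hsum := Subspace.finrank_add_finrank_dualAnnihilator_eq (Submodule.span ℝ (S₁ : Set V))
  calc 2 * (A₁.card * B₂.card) = S₁.card * S₂.card := by rw [hS₁c, hS₂c]; ring
    _ ≤ 2 ^ finrank ℝ (Submodule.span ℝ (S₁ : Set V)) *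
        2 ^ finrank ℝ (Submodule.span ℝ (S₂ : Set (Dual ℝ V))) := Nat.mul_le_mul h1 h2
    _ = 2 ^ (finrank ℝ (Submodule.span ℝ (S₁ : Set V)) +
        finrank ℝ (Submodule.span ℝ (S₂ : Set (Dual ℝ V)))) := (pow_add _ _ _).symm
    _ ≤ 2 ^ finrank ℝ V := Nat.pow_le_pow_right (by norm_num) (by omega)

/-- The points of `A` in the kernel of a facet functional at the origin, inside that kernel. -/
theorem card_filter_mul_card_le {d : ℕ} {A : Finset V} {c : Dual ℝ V}
    (hd : finrank ℝ V = d + 1)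
    (ih : ∀ (A' : Finset (LinearMap.ker c)) (B' : Finset (Dual ℝ (LinearMap.ker c))),
      finrank ℝ (LinearMap.ker c) = d → vectorSpan ℝ (A' : Set (LinearMap.ker c)) = ⊤ →
      Submodule.span ℝ (B' : Set (Dual ℝ (LinearMap.ker c))) = ⊤ →
      (∀ a ∈ A', ∀ b ∈ B', b a = 0 ∨ b a = 1) → A'.card * B'.card ≤ (d + 1) * 2 ^ d)
    (hc : IsFacetFunctional A c 0) {B : Finset (Dual ℝ V)}
    (hB : Submodule.span ℝ (B : Set (Dual ℝ V)) = ⊤)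
    (hAB : ∀ a ∈ A, c a = 0 → ∀ b ∈ B, b a = 0 ∨ b a = 1) [DecidableEq (Dual ℝ (LinearMap.ker c))] :
    {a ∈ A | c a = 0}.card * (B.image fun b => b.domRestrict (LinearMap.ker c)).card ≤
      (d + 1) * 2 ^ d := by
  classical
  obtain ⟨h0, hc0, -, hspan⟩ := hc
  have hmemW : ∀ a ∈ {a ∈ A | c a = 0}, a ∈ LinearMap.ker c := fun a ha => (Finset.mem_filter.1 ha).2
  set A' : Finset (LinearMap.ker c) := {a ∈ A | c a = 0}.subtype (· ∈ LinearMap.ker c) with hA'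
  have hcard : A'.card = {a ∈ A | c a = 0}.card := by
    rw [hA', Finset.card_subtype, Finset.filter_true_of_mem hmemW]
  rw [← hcard]
  have himg : (LinearMap.ker c).subtype '' (A' : Set (LinearMap.ker c)) = {a ∈ (A : Set V) | c a = c 0} := by
    ext x
    simp only [Set.mem_image, Finset.mem_coe, hA', Finset.mem_subtype, Finset.mem_filter,
      Submodule.subtype_apply, Subtype.exists, map_zero, Set.mem_ofPred_eq]
    constructor
    · rintro ⟨y, hy, h, rfl⟩; exact h
    · rintro h; exact ⟨x, h.2, h, rfl⟩
  refine ih A' _ ?_ ?_ ?_ ?_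
  · have := Dual.finrank_ker_add_one_of_ne_zero hc0
    omega
  · have h0A' : (0 : LinearMap.ker c) ∈ (A' : Set (LinearMap.ker c)) := by
      simp [hA', h0]
    have h0A : (0 : V) ∈ {a ∈ (A : Set V) | c a = c 0} := ⟨h0, rfl⟩
    rw [← span_eq_vectorSpan_of_zero_mem h0A']
    rw [← span_eq_vectorSpan_of_zero_mem h0A, ← himg, Submodule.span_image] at hspan
    apply Submodule.map_injective_of_injective (LinearMap.ker c).subtype_injective
    rw [hspan, Submodule.map_top, Submodule.range_subtype]
  · rw [Finset.coe_image]
    exact span_image_domRestrict_eq_top hB _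
  · intro a ha b hb
    obtain ⟨b', hb', rfl⟩ := Finset.mem_image.1 hb
    rw [hA', Finset.mem_subtype, Finset.mem_filter] at ha
    exact hAB a ha.1 ha.2 b' hb'

end BinaryProducts

/-! ### Binary products: the inductive step and the main bound -/

section BinaryProducts

universe u

variable {V : Type u} [AddCommGroup V] [Module ℝ V]

theorem exists_eq_add_smul_of_domRestrict_ker_eq {c b b' : Dual ℝ V}
    (h : b.domRestrict (LinearMap.ker c) = b'.domRestrict (LinearMap.ker c)) :
    ∃ t : ℝ, b' = b + t • c := by
  obtain ⟨t, ht⟩ := exists_eq_smul_of_ker_le (f := c) (g := b' - b) fun w hw => by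
    have := congrArg (fun f : Dual ℝ (LinearMap.ker c) => f ⟨w, hw⟩) h
    simp only [LinearMap.domRestrict_apply] at this
    simp [this]
  exact ⟨t, by rw [← ht]; abel⟩

/-- Split `A` into the `x` points on the facet and the rest `A₁`, and `B` into `B₂`, the functionals
whose translate by `t • c` stays in `B`, and the rest `B₁`. Induction bounds `x * |B₁|`,
orthogonality bounds `|A₁| * |B₂|`, and the mixed terms are absorbed by rearrangement. -/
theorem card_mul_card_le_of_isFacetFunctional [FiniteDimensional ℝ V] {d : ℕ} {A : Finset V} {B : Finset (Dual ℝ V)}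
    {c : Dual ℝ V} (hd : finrank ℝ V = d + 1)
    (ih : ∀ (A' : Finset (LinearMap.ker c)) (B' : Finset (Dual ℝ (LinearMap.ker c))),
      finrank ℝ (LinearMap.ker c) = d → vectorSpan ℝ (A' : Set (LinearMap.ker c)) = ⊤ →
      Submodule.span ℝ (B' : Set (Dual ℝ (LinearMap.ker c))) = ⊤ →
      (∀ a ∈ A', ∀ b ∈ B', b a = 0 ∨ b a = 1) → A'.card * B'.card ≤ (d + 1) * 2 ^ d)
    (hA : vectorSpan ℝ (A : Set V) = ⊤) (hB : Submodule.span ℝ (B : Set (Dual ℝ V)) = ⊤)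
    (hAB : ∀ a ∈ A, ∀ b ∈ B, b a = 0 ∨ b a = 1)
    (hc : IsFacetFunctional A c 0) (hhalf : A.card ≤ 2 * {a ∈ A | c a = 0}.card) :
    A.card * B.card ≤ (d + 2) * 2 ^ (d + 1) := by
  classical
  have hxp := card_filter_mul_card_le hd ih hc hB fun a ha _ => hAB a ha
  obtain ⟨h0, hc0, hnn, -⟩ := hc
  set x := {a ∈ A | c a = 0}.card with hx
  set res : Dual ℝ V → Dual ℝ (LinearMap.ker c) := fun b => b.domRestrict (LinearMap.ker c) with hres
  by_cases hinj : Set.InjOn res B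
  · rw [Finset.card_image_of_injOn hinj] at hxp
    calc A.card * B.card ≤ 2 * x * B.card := Nat.mul_le_mul_right _ hhalf
      _ = 2 * (x * B.card) := by ring
      _ ≤ 2 * ((d + 1) * 2 ^ d) := Nat.mul_le_mul_left _ hxp
      _ = (d + 1) * 2 ^ (d + 1) := by ring
      _ ≤ _ := Nat.mul_le_mul_right _ (by omega)
  obtain ⟨t, ht, b₁, hb₁, b₂, hb₂, hb₁₂⟩ : ∃ t : ℝ, 0 < t ∧ ∃ b₁ ∈ B, ∃ b₂ ∈ B, b₂ = b₁ + t • c := by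
    simp only [Set.InjOn, not_forall] at hinj
    obtain ⟨b₁, hb₁, b₂, hb₂, hrr, hne⟩ := hinj
    obtain ⟨t, ht⟩ := exists_eq_add_smul_of_domRestrict_ker_eq hrr
    rcases lt_trichotomy t 0 with h | h | h
    · exact ⟨-t, neg_pos.2 h, b₂, hb₂, b₁, hb₁, by rw [ht]; ext; simp⟩
    · exact absurd (by rw [ht, h]; simp) hne
    · exact ⟨t, h, b₁, hb₁, b₂, hb₂, ht⟩
  -- Here `t • c` is a positive difference of two binary values.
  have hone : ∀ a ∈ A, c a ≠ 0 → (t • c) a = 1 := by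
    intro a ha hca
    have hpos : 0 < t * c a := mul_pos ht (lt_of_le_of_ne (by simpa using hnn a ha) hca.symm)
    have h2 : b₂ a = b₁ a + t * c a := by rw [hb₁₂]; simp
    simp only [LinearMap.smul_apply, smul_eq_mul]
    rcases hAB a ha b₁ hb₁ with h | h <;> rcases hAB a ha b₂ hb₂ with h' | h' <;> linarith
  set A₁ := {a ∈ A | ¬ c a = 0} with hA₁
  set B₂ := {b ∈ B | b + t • c ∈ B} with hB₂
  have hA₁ne : A₁.Nonempty := by
    by_contra hemp
    rw [Finset.not_nonempty_iff_eq_empty, hA₁, Finset.filter_eq_empty_iff] at hemp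
    exact hc0 (eq_zero_of_forall_eq hA (y := 0) fun a ha => by simpa using hemp ha)
  obtain ⟨a₁, ha₁⟩ := hA₁ne
  have hort : ∀ a ∈ A₁, ∀ b ∈ B₂, b a = 0 := by
    intro a ha b hb
    obtain ⟨ha, hca⟩ := Finset.mem_filter.1 ha
    obtain ⟨hb, hbc⟩ := Finset.mem_filter.1 hb
    have h1 := hone a ha hca
    have h2 := hAB a ha _ hbc
    rw [LinearMap.add_apply, h1] at h2
    rcases hAB a ha b hb with h | h
    · exact h
    · rw [h] at h2; norm_num at h2
  have hyq : 2 * (A₁.card * B₂.card) ≤ 2 ^ (d + 1) := by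
    rw [← hd]
    refine two_mul_card_mul_card_le ?_ hB hAB (Finset.filter_subset _ _) ⟨a₁, ha₁⟩
      (Finset.filter_subset _ _) (fun b hb => (Finset.mem_filter.1 hb).2) ?_ hort
    · rw [span_eq_vectorSpan_of_zero_mem (by exact_mod_cast h0), hA]
    · intro a ha
      exact hone a (Finset.mem_filter.1 ha).1 (Finset.mem_filter.1 ha).2
  set B₁ := {b ∈ B | ¬ b + t • c ∈ B} with hB₁
  have hcA : x + A₁.card = A.card := Finset.card_filter_add_card_filter_not _
  have hcB : B₂.card + B₁.card = B.card := Finset.card_filter_add_card_filter_not _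
  obtain ⟨ha₁A, ha₁c⟩ := Finset.mem_filter.1 ha₁
  -- Functionals with equal restriction differ by `0` or `± t • c`; in the nonzero cases the lower
  -- of the two is not in `B₁`.
  have hB₁p : B₁.card ≤ (B.image res).card := by
    rw [← Finset.card_image_of_injOn (s := B₁) (f := res)]
    · exact Finset.card_le_card (Finset.image_subset_image (Finset.filter_subset _ _))
    · intro b hb b' hb' hbb
      rw [Finset.mem_coe, Finset.mem_filter] at hb hb'
      obtain ⟨s, hs⟩ := exists_eq_add_smul_of_domRestrict_ker_eq hbb
      have h1 : t * c a₁ = 1 := hone a₁ ha₁A ha₁c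
      have h2 : b' a₁ = b a₁ + s * c a₁ := by rw [hs]; simp
      have hs3 : s = 0 ∨ s = t ∨ s = -t := by
        rcases hAB a₁ ha₁A b hb.1 with h | h <;> rcases hAB a₁ ha₁A b' hb'.1 with h' | h' <;>
          rw [h, h'] at h2
        · left; simpa [ha₁c] using h2
        · right; left; exact mul_right_cancel₀ ha₁c (by linarith)
        · right; right; exact mul_right_cancel₀ ha₁c (by linarith)
        · left; simpa [ha₁c] using h2
      rcases hs3 with h | h | h
      · rw [hs, h]; simp
      · exact absurd (by rw [← h, ← hs]; exact hb'.1) hb.2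
      · refine absurd ?_ hb'.2
        have hbt : b' + t • c = b := by rw [hs, h]; ext; simp
        rw [hbt]
        exact hb.1
  have hqB₁ : B₂.card ≤ B₁.card := by
    refine Finset.card_le_card_of_injOn (fun b => b + t • c) ?_ (add_left_injective _).injOn
    intro b hb
    have hz := hort a₁ ha₁ b hb
    obtain ⟨hb, hbc⟩ := Finset.mem_filter.1 hb
    refine Finset.mem_filter.2 ⟨hbc, fun h => ?_⟩
    have h1 := hone a₁ ha₁A ha₁c
    have h2 := hAB a₁ ha₁A _ h
    simp only [LinearMap.add_apply, h1, hz] at h2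
    norm_num at h2
  have hyx : A₁.card ≤ x := by omega
  have hxp' : x * B₁.card ≤ (d + 1) * 2 ^ d := (Nat.mul_le_mul_left _ hB₁p).trans hxp
  rw [← hcA, ← hcB]
  -- Rearrangement, from `A₁.card ≤ x` and `B₂.card ≤ B₁.card`. The full product is then at most
  -- twice the right side, that is `2 * ((d + 1) * 2 ^ d + 2 ^ d)`.
  have hre : x * B₂.card + A₁.card * B₁.card ≤ x * B₁.card + A₁.card * B₂.card := by
    obtain ⟨k, hk⟩ := Nat.exists_eq_add_of_le hyx
    obtain ⟨l, hl⟩ := Nat.exists_eq_add_of_le hqB₁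
    rw [hk, hl]
    nlinarith [Nat.zero_le (k * l)]
  have h2 : (2 : ℕ) ^ (d + 1) = 2 * 2 ^ d := by ring
  nlinarith

/-- Replacing functionals by their negatives, the values `b a - b a₁` become binary. -/
theorem exists_signs {A : Finset V} {B : Finset (Dual ℝ V)} {a₁ : V} (ha₁ : a₁ ∈ A)
    (hB : Submodule.span ℝ (B : Set (Dual ℝ V)) = ⊤)
    (hAB : ∀ a ∈ A, ∀ b ∈ B, b a = 0 ∨ b a = 1) :
    ∃ B' : Finset (Dual ℝ V), B'.card = B.card ∧ Submodule.span ℝ (B' : Set (Dual ℝ V)) = ⊤ ∧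
      ∀ a ∈ A, ∀ b ∈ B', b (a - a₁) = 0 ∨ b (a - a₁) = 1 := by
  classical
  set σ : Dual ℝ V → Dual ℝ V := fun b => if b a₁ = 0 then b else -b with hσ
  refine ⟨B.image σ, Finset.card_image_of_injOn ?_, ?_, ?_⟩
  · intro b hb b' hb' h
    have h1 := hAB a₁ ha₁ b hb
    have h2 := hAB a₁ ha₁ b' hb'
    have h3 := congrArg (fun f : Dual ℝ V => f a₁) h
    simp only [hσ] at h h3
    split_ifs at h h3 with h4 h5 h5
    · exact h
    · simp only [h4, LinearMap.neg_apply] at h3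
      exact absurd (by linarith) h5
    · simp only [h5, LinearMap.neg_apply] at h3
      exact absurd (by linarith) h4
    · exact neg_injective h
  · rw [eq_top_iff, ← hB, Submodule.span_le]
    intro b hb
    have hmem : σ b ∈ Submodule.span ℝ ((B.image σ : Finset (Dual ℝ V)) : Set (Dual ℝ V)) :=
      Submodule.subset_span (Finset.mem_coe.2 (Finset.mem_image_of_mem σ hb))
    simp only [hσ] at hmem
    split_ifs at hmem
    · exact hmem
    · exact (Submodule.neg_mem_iff _).1 hmem
  · intro a ha b hb
    obtain ⟨b, hb', rfl⟩ := Finset.mem_image.1 hb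
    have h1 := hAB a₁ ha₁ b hb'
    have h2 := hAB a ha b hb'
    simp only [hσ]
    split_ifs with h
    · simpa [h] using h2
    · have h3 := h1.resolve_left h
      rcases h2 with h2 | h2 <;> simp [h2, h3]

theorem IsFacetFunctional.image_sub [DecidableEq V] {A : Finset V} {c : Dual ℝ V} {a₁ : V}
    (h : IsFacetFunctional A c a₁) : IsFacetFunctional (A.image fun a => a - a₁) c 0 := by
  obtain ⟨h1, h2, h3, h4⟩ := h
  refine ⟨Finset.mem_image.2 ⟨a₁, h1, sub_self _⟩, h2, ?_, ?_⟩
  · intro x hx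
    obtain ⟨a, ha, rfl⟩ := Finset.mem_image.1 hx
    simpa using h3 a ha
  · rw [← h4, ← vectorSpan_image_sub {a ∈ (A : Set V) | c a = c a₁} a₁]
    congr 1
    ext x
    simp only [Finset.coe_image, Set.mem_ofPred_eq, Set.mem_image, Finset.mem_coe, map_zero]
    constructor
    · rintro ⟨⟨a, ha, hax⟩, hx⟩
      exact ⟨a, ⟨ha, by simpa [← hax, sub_eq_zero] using hx⟩, hax⟩
    · rintro ⟨a, ⟨ha, hx⟩, hax⟩
      exact ⟨⟨a, ha, hax⟩, by simp [← hax, hx]⟩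

/-- If `A` spans `V` affinely, `B` spans the dual of `V`, and all products are binary, then
`|A| |B| ≤ (d + 1) 2 ^ d`. -/
theorem card_mul_card_le_of_binary (d : ℕ) {V : Type u} [AddCommGroup V] [Module ℝ V]
    [FiniteDimensional ℝ V] (A : Finset V) (B : Finset (Dual ℝ V)) (hd : finrank ℝ V = d)
    (hA : vectorSpan ℝ (A : Set V) = ⊤) (hB : Submodule.span ℝ (B : Set (Dual ℝ V)) = ⊤)
    (hAB : ∀ a ∈ A, ∀ b ∈ B, b a = 0 ∨ b a = 1) :
    A.card * B.card ≤ (d + 1) * 2 ^ d := by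
  classical
  induction d generalizing V with
  | zero =>
    have := finrank_zero_iff.1 hd
    have : Subsingleton (Dual ℝ V) := ⟨fun f g => LinearMap.ext fun x => by
      rw [Subsingleton.elim x 0, map_zero, map_zero]⟩
    have h1 := Finset.card_le_one_of_subsingleton A
    have h2 := Finset.card_le_one_of_subsingleton B
    simpa using Nat.mul_le_mul h1 h2
  | succ d ih =>
    rcases A.eq_empty_or_nonempty with rfl | hAne
    · simp
    obtain ⟨b, hb, hb0⟩ : ∃ b ∈ B, b ≠ 0 := by
      by_contra! hcon
      have : Submodule.span ℝ (B : Set (Dual ℝ V)) ≤ ⊥ := by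
        rw [Submodule.span_le]
        exact fun b hb => hcon b hb
      rw [hB, top_le_iff, eq_comm] at this
      have hs := congrArg (fun U : Submodule ℝ (Dual ℝ V) => finrank ℝ U) this
      simp only [finrank_top, Subspace.dual_finrank_eq, finrank_bot] at hs
      omega
    obtain ⟨c, a₁, hc, hhalf⟩ := exists_isFacetFunctional_half hA hb0 hAne fun a ha => hAB a ha b hb
    obtain ⟨B', hcard, hB', hAB'⟩ := exists_signs hc.1 hB hAB
    rw [← hcard, ← Finset.card_image_of_injective A (f := fun a => a - a₁) sub_left_injective]
    refine card_mul_card_le_of_isFacetFunctional hd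
      (fun A'' B'' hd' hA'' hB'' h => ih A'' B'' hd' hA'' hB'' h) ?_ hB' ?_ hc.image_sub ?_
    · rw [Finset.coe_image, vectorSpan_image_sub, hA]
    · intro x hx
      obtain ⟨a, ha, rfl⟩ := Finset.mem_image.1 hx
      exact hAB' a ha
    · rw [Finset.card_image_of_injective A sub_left_injective]
      refine hhalf.trans (Nat.mul_le_mul_left _ ?_)
      refine Finset.card_le_card_of_injOn (fun a => a - a₁) ?_ sub_left_injective.injOn
      intro a ha
      obtain ⟨ha, hca⟩ := Finset.mem_filter.1 ha
      exact Finset.mem_filter.2 ⟨Finset.mem_image_of_mem _ ha, by simp [hca]⟩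

end BinaryProducts

/-! ### Counting facets of a two-level point set -/

section FacetCount

universe u

variable {V : Type u} [AddCommGroup V] [Module ℝ V]

/-- The subsets of `A` cut out by facets of the convex hull of `A`. -/
def facetSets (A : Finset V) : Set (Finset V) :=
  {S | ∃ c a₁, IsFacetFunctional A c a₁ ∧ S = {a ∈ A | c a = c a₁}}

theorem IsFacetFunctional.smul {A : Finset V} {c : Dual ℝ V} {a₁ : V}
    (h : IsFacetFunctional A c a₁) {t : ℝ} (ht : 0 < t) : IsFacetFunctional A (t • c) a₁ := by
  obtain ⟨h1, h2, h3, h4⟩ := h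
  refine ⟨h1, smul_ne_zero ht.ne' h2, fun a ha => ?_, ?_⟩
  · simpa using mul_le_mul_of_nonneg_left (h3 a ha) ht.le
  · have : LinearMap.ker (t • c) = LinearMap.ker c := LinearMap.ker_smul _ _ ht.ne'
    rw [this, ← h4]
    congr 1
    ext a
    simp [ht.ne']

theorem exists_binary_of_mem_facetSets {A : Finset V} (hA : vectorSpan ℝ (A : Set V) = ⊤)
    (h2 : ∀ c a₁, IsFacetFunctional A c a₁ → ∃ m' : ℝ, ∀ a ∈ A, c a = c a₁ ∨ c a = m')
    {S : Finset V} (hS : S ∈ facetSets A) :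
    ∃ c a₁, IsFacetFunctional A c a₁ ∧ S = {a ∈ A | c a = c a₁} ∧
      ∀ a ∈ A, c a = c a₁ ∨ c a = c a₁ + 1 := by
  obtain ⟨c, a₁, hc, rfl⟩ := hS
  obtain ⟨m', hm'⟩ := h2 c a₁ hc
  have hlt : c a₁ < m' := by
    obtain ⟨a, ha, hne⟩ : ∃ a ∈ A, c a ≠ c a₁ := by
      by_contra! hcon
      exact hc.2.1 (eq_zero_of_forall_eq hA hcon)
    rw [← (hm' a ha).resolve_left hne]
    exact lt_of_le_of_ne (hc.2.2.1 a ha) hne.symm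
  have ht : 0 < (m' - c a₁)⁻¹ := inv_pos.2 (sub_pos.2 hlt)
  refine ⟨(m' - c a₁)⁻¹ • c, a₁, hc.smul ht, ?_, fun a ha => ?_⟩
  · ext a
    simp [(sub_pos.2 hlt).ne']
  · rcases hm' a ha with h | h
    · left; simp [h]
    · right
      simp only [LinearMap.smul_apply, smul_eq_mul, h]
      field_simp [(sub_pos.2 hlt).ne']
      ring

theorem eq_of_subset_of_isFacetFunctional [FiniteDimensional ℝ V] {A : Finset V}
    {c c' : Dual ℝ V} {a a' : V} (hc : IsFacetFunctional A c a) (hc' : IsFacetFunctional A c' a')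
    (h : ∀ x ∈ A, c x = c a → c' x = c' a') : ∀ x ∈ A, c' x = c' a' → c x = c a := by
  have hle : LinearMap.ker c ≤ LinearMap.ker c' := by
    rw [← hc.2.2.2, ← hc'.2.2.2]
    exact vectorSpan_mono ℝ fun x hx => ⟨hx.1, h x hx.1 hx.2⟩
  obtain ⟨t, rfl⟩ := exists_eq_smul_of_ker_le hle
  have ht : t ≠ 0 := fun ht => hc'.2.1 (by rw [ht]; ext; simp)
  have ha := h a hc.1 rfl
  intro x _ hx
  rw [← ha] at hx
  simpa [ht] using hx

/-- Every functional attains its minimum on `A`, hence lies in a span of facet functionals; each of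
these is a multiple of the functional chosen for the same facet. -/
theorem span_eq_top_of_forall_mem_facetSets [FiniteDimensional ℝ V] {A : Finset V}
    (hA : vectorSpan ℝ (A : Set V) = ⊤) (hAne : A.Nonempty)
    {𝓕 : Finset (Finset V)} (h𝓕 : ∀ S ∈ facetSets A, S ∈ 𝓕) {c : Finset V → Dual ℝ V}
    {p : Finset V → V}
    (hc : ∀ S ∈ 𝓕, IsFacetFunctional A (c S) (p S) ∧ S = {a ∈ A | c S a = c S (p S)}) :
    Submodule.span ℝ (c '' 𝓕) = ⊤ := by
  rw [eq_top_iff]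
  rintro f -
  obtain ⟨a₁, ha₁, hmin⟩ := A.exists_min_image f hAne
  refine (Submodule.span_le.2 ?_) (mem_span_isFacetFunctional hA ha₁ f hmin)
  rintro g ⟨hg, -⟩
  have hmem := h𝓕 {a ∈ A | g a = g a₁} ⟨g, a₁, hg, rfl⟩
  obtain ⟨hcS, hS⟩ := hc _ hmem
  set S := {a ∈ A | g a = g a₁} with hSdef
  have hle : LinearMap.ker (c S) ≤ LinearMap.ker g := by
    rw [← hg.2.2.2, ← hcS.2.2.2]
    refine vectorSpan_mono ℝ fun x hx => ?_
    have hxS : x ∈ S := by rw [hS]; exact Finset.mem_filter.2 hx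
    exact Finset.mem_filter.1 hxS
  obtain ⟨t, ht⟩ := exists_eq_smul_of_ker_le hle
  rw [SetLike.mem_coe, ht]
  exact Submodule.smul_mem _ _ (Submodule.subset_span ⟨S, hmem, rfl⟩)

/-- The restrictions to the kernel of a facet functional determine the facets. -/
theorem facet_subset_of_domRestrict_eq [FiniteDimensional ℝ V] {A : Finset V}
    (hA : vectorSpan ℝ (A : Set V) = ⊤) {c₀ c c' : Dual ℝ V} {a₀ a a' : V}
    (h₀ : IsFacetFunctional A c₀ a₀) (h : IsFacetFunctional A c a) (h' : IsFacetFunctional A c' a')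
    (hb₀ : ∀ x ∈ A, c₀ x = c₀ a₀ ∨ c₀ x = c₀ a₀ + 1)
    (hb : ∀ x ∈ A, c x = c a ∨ c x = c a + 1) (hb' : ∀ x ∈ A, c' x = c' a' ∨ c' x = c' a' + 1)
    (heq : c.domRestrict (LinearMap.ker c₀) = c'.domRestrict (LinearMap.ker c₀))
    (hval : c a₀ - c a = c' a₀ - c' a') : ∀ x ∈ A, c x = c a → c' x = c' a' := by
  obtain ⟨t, ht⟩ := exists_eq_add_smul_of_domRestrict_ker_eq heq
  -- In terms of slacks, `s' = s + t * s₀` with all three binary on `A`, so `t` is `0`, `1` or `-1`.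
  -- If `t = 1`, a zero of `s'` is one of `s₀`, and maximality of facets makes all three facets
  -- equal; if `t = -1`, a zero of `s` is one of `s₀`, hence of `s'`.
  have hx : ∀ x, c' x - c' a' = (c x - c a) + t * (c₀ x - c₀ a₀) := fun x => by
    have h1 : ∀ y, c' y = c y + t * c₀ y := fun y => by rw [ht]; simp
    have h2 := h1 x
    have h3 := h1 a₀
    linarith
  obtain ⟨z, hz, hz0⟩ : ∃ z ∈ A, c₀ z ≠ c₀ a₀ := by
    by_contra! hcon
    exact h₀.2.1 (eq_zero_of_forall_eq hA hcon)
  have ht3 : t = 0 ∨ t = 1 ∨ t = -1 := by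
    have h1 := hx z
    rw [(hb₀ z hz).resolve_left hz0] at h1
    rcases hb z hz with h2 | h2 <;> rcases hb' z hz with h3 | h3 <;> rw [h2, h3] at h1
    · left; linarith
    · right; left; linarith
    · right; right; linarith
    · left; linarith
  rcases ht3 with rfl | rfl | rfl
  · intro x hxA hcx
    have := hx x
    rw [hcx] at this
    linarith
  · have hsub : ∀ x ∈ A, c' x = c' a' → c₀ x = c₀ a₀ := fun x hxA hcx => by
      have h1 := hx x
      rcases hb₀ x hxA with h2 | h2
      · exact h2
      · rcases hb x hxA with h3 | h3 <;> rw [h2, h3, hcx] at h1 <;> linarith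
    have hsup := eq_of_subset_of_isFacetFunctional h' h₀ hsub
    have hsub' : ∀ x ∈ A, c₀ x = c₀ a₀ → c x = c a := fun x hxA hcx => by
      have h1 := hx x
      rw [hsup x hxA hcx, hcx] at h1
      linarith
    intro x hxA hcx
    exact hsup x hxA (eq_of_subset_of_isFacetFunctional h₀ h hsub' x hxA hcx)
  · have hsub : ∀ x ∈ A, c x = c a → c₀ x = c₀ a₀ := fun x hxA hcx => by
      have h1 := hx x
      rcases hb₀ x hxA with h2 | h2
      · exact h2
      · rcases hb' x hxA with h3 | h3 <;> rw [h2, h3, hcx] at h1 <;> linarith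
    intro x hxA hcx
    have h1 := hx x
    rw [hcx, hsub x hxA hcx] at h1
    linarith

/-- Applying the binary bound inside the hyperplane of a large facet, rather than in `V`, is what
gives `d + 1` instead of `d + 2` as the linear factor. -/
theorem card_mul_card_facetSets_le [FiniteDimensional ℝ V] {d : ℕ} {A : Finset V}
    (hd : finrank ℝ V = d + 1) (hAne : A.Nonempty) (hA : vectorSpan ℝ (A : Set V) = ⊤)
    (h2 : ∀ c a₁, IsFacetFunctional A c a₁ → ∃ m' : ℝ, ∀ a ∈ A, c a = c a₁ ∨ c a = m')
    {𝓕 : Finset (Finset V)} (h𝓕 : ∀ S, S ∈ 𝓕 ↔ S ∈ facetSets A) :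
    A.card * 𝓕.card ≤ (d + 1) * 2 ^ (d + 2) := by
  classical
  have hex : ∀ S ∈ 𝓕, ∃ c a₁, IsFacetFunctional A c a₁ ∧ S = {a ∈ A | c a = c a₁} ∧
      ∀ a ∈ A, c a = c a₁ ∨ c a = c a₁ + 1 := fun S hS =>
    exists_binary_of_mem_facetSets hA h2 ((h𝓕 S).1 hS)
  choose! c p hfac hS hbin using hex
  obtain ⟨S₀, hS₀, hhalf⟩ : ∃ S ∈ 𝓕, A.card ≤ 2 * S.card := by
    obtain ⟨f, hf⟩ : ∃ f : Dual ℝ V, f ≠ 0 := by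
      have : Nontrivial (Dual ℝ V) := by
        apply nontrivial_of_finrank_pos (R := ℝ)
        rw [Subspace.dual_finrank_eq]
        omega
      exact exists_ne 0
    obtain ⟨a₁, ha₁, hmin⟩ := A.exists_min_image f hAne
    obtain ⟨g, hg, -⟩ := exists_isFacetFunctional hA ha₁ hf hmin
    obtain ⟨m', hm'⟩ := h2 g a₁ hg
    obtain ⟨k, a₂, hk, hcard⟩ := exists_isFacetFunctional_half hA hg.2.1 hAne hm'
    exact ⟨_, (h𝓕 _).2 ⟨k, a₂, hk, rfl⟩, hcard⟩
  set c₀ := c S₀ with hc₀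
  set a₀ := p S₀ with ha₀
  have h₀ : IsFacetFunctional A c₀ a₀ := hfac S₀ hS₀
  -- The sign makes values on `a - a₀` binary: facets missing `a₀` have slack 1 there and are
  -- negated.
  set σ : Finset V → Dual ℝ V := fun S => if c S a₀ = c S (p S) then c S else -c S with hσ
  have hσspan : Submodule.span ℝ ((𝓕.image σ : Finset (Dual ℝ V)) : Set (Dual ℝ V)) = ⊤ := by
    rw [eq_top_iff, ← span_eq_top_of_forall_mem_facetSets hA hAne (fun S hS => (h𝓕 S).2 hS)
      (fun S hS' => ⟨hfac S hS', hS S hS'⟩), Submodule.span_le]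
    rintro _ ⟨S, hS, rfl⟩
    have hmem : σ S ∈ Submodule.span ℝ ((𝓕.image σ : Finset (Dual ℝ V)) : Set (Dual ℝ V)) :=
      Submodule.subset_span (Finset.mem_coe.2 (Finset.mem_image_of_mem σ hS))
    simp only [hσ] at hmem
    split_ifs at hmem
    · exact hmem
    · exact (Submodule.neg_mem_iff _).1 hmem
  have hmain := card_filter_mul_card_le (B := 𝓕.image σ) hd
    (fun A' B' hd' hA' hB' h => card_mul_card_le_of_binary d A' B' hd' hA' hB' h)
    h₀.image_sub hσspan (by
      intro x hx _ b hb
      obtain ⟨y, hy, rfl⟩ := Finset.mem_image.1 hx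
      obtain ⟨S, hS', rfl⟩ := Finset.mem_image.1 hb
      simp only [hσ]
      have hy' := hbin S hS' y hy
      split_ifs with h
      · rcases hy' with h' | h' <;> simp [h, h']
      · have h3 := (hbin S hS' a₀ h₀.1).resolve_left h
        rcases hy' with h' | h' <;> simp [h3, h'])
  set R := (𝓕.image σ).image fun b => b.domRestrict (LinearMap.ker c₀) with hR
  have hS₀card : S₀.card ≤ {x ∈ A.image (fun a => a - a₀) | c₀ x = 0}.card := by
    refine Finset.card_le_card_of_injOn (fun a => a - a₀) ?_ sub_left_injective.injOn
    intro a ha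
    rw [hS S₀ hS₀] at ha
    obtain ⟨ha, hca⟩ := Finset.mem_filter.1 ha
    exact Finset.mem_filter.2 ⟨Finset.mem_image_of_mem _ ha, by simp [c₀, a₀, hca]⟩
  have h𝓕card : 𝓕.card ≤ 2 * R.card := by
    have hcard : (R ×ˢ (Finset.univ : Finset Bool)).card = 2 * R.card := by
      rw [Finset.card_product, Finset.card_univ, Fintype.card_bool, mul_comm]
    rw [← hcard]
    -- The bit tells whether the facet contains `a₀`; it recovers both the sign and the slack at
    -- `a₀`.
    refine Finset.card_le_card_of_injOn
      (fun S => ((σ S).domRestrict (LinearMap.ker c₀), decide (c S a₀ = c S (p S)))) ?_ ?_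
    · intro S hS
      exact Finset.mem_coe.2 (Finset.mem_product.2
        ⟨Finset.mem_image_of_mem _ (Finset.mem_image_of_mem _ hS), Finset.mem_univ _⟩)
    · intro S hSF S' hSF' hSS
      simp only [Prod.mk.injEq, decide_eq_decide] at hSS
      obtain ⟨hres, hiff⟩ := hSS
      have hval : c S a₀ - c S (p S) = c S' a₀ - c S' (p S') := by
        by_cases h : c S a₀ = c S (p S)
        · rw [h, hiff.1 h, sub_self, sub_self]
        · rw [(hbin S hSF a₀ h₀.1).resolve_left h,
            (hbin S' hSF' a₀ h₀.1).resolve_left fun h' => h (hiff.2 h')]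
          ring
      have hres' : (c S).domRestrict (LinearMap.ker c₀) =
          (c S').domRestrict (LinearMap.ker c₀) := by
        simp only [hσ] at hres
        by_cases h : c S a₀ = c S (p S)
        · rwa [if_pos h, if_pos (hiff.1 h)] at hres
        · rw [if_neg h, if_neg fun h' => h (hiff.2 h')] at hres
          ext w
          have := congrArg (fun f : Dual ℝ (LinearMap.ker c₀) => f w) hres
          simpa using this
      rw [hS S hSF, hS S' hSF']
      refine Finset.filter_congr fun x hx => ⟨?_, ?_⟩
      · exact facet_subset_of_domRestrict_eq hA h₀ (hfac S hSF) (hfac S' hSF') (hbin S₀ hS₀)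
          (hbin S hSF) (hbin S' hSF') hres' hval x hx
      · exact facet_subset_of_domRestrict_eq hA h₀ (hfac S' hSF') (hfac S hSF) (hbin S₀ hS₀)
          (hbin S' hSF') (hbin S hSF) hres'.symm hval.symm x hx
  calc A.card * 𝓕.card ≤ (2 * S₀.card) * (2 * R.card) := Nat.mul_le_mul hhalf h𝓕card
    _ = 4 * (S₀.card * R.card) := by ring
    _ ≤ 4 * ((d + 1) * 2 ^ d) :=
      Nat.mul_le_mul_left _ ((Nat.mul_le_mul_right _ hS₀card).trans hmain)
    _ = (d + 1) * 2 ^ (d + 2) := by ring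

end FacetCount

/-! ### Polytopes and their exposed faces as hulls of vertices -/

section Polytope

variable {E : Type*} [NormedAddCommGroup E] [NormedSpace ℝ E]

theorem vectorSpan_convexHull (S : Set E) : vectorSpan ℝ (convexHull ℝ S) = vectorSpan ℝ S := by
  rw [← direction_affineSpan, affineSpan_convexHull, direction_affineSpan]

theorem IsPolytope.finite_vertices {P : Set E} (hP : IsPolytope P) : (vertices P).Finite := by
  obtain ⟨s, rfl⟩ := hP
  exact s.finite_toSet.subset extremePoints_convexHull_subset

theorem IsPolytope.isCompact {P : Set E} (hP : IsPolytope P) : IsCompact P := by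
  obtain ⟨s, rfl⟩ := hP
  exact s.finite_toSet.isCompact_convexHull ℝ

theorem IsPolytope.convex {P : Set E} (hP : IsPolytope P) : Convex ℝ P := by
  obtain ⟨s, rfl⟩ := hP
  exact convex_convexHull ℝ _

/-- Krein–Milman: the extreme points of an exposed face are the vertices of `P` in it, and with
finitely many of them no closure is needed. -/
theorem IsPolytope.convexHull_inter_vertices {P F : Set E} (hP : IsPolytope P)
    (hF : IsExposed ℝ P F) : convexHull ℝ (F ∩ vertices P) = F := by
  have hfin : (F ∩ vertices P).Finite := hP.finite_vertices.inter_of_right F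
  have h := closure_convexHull_extremePoints (hF.isCompact hP.isCompact) (hF.convex hP.convex)
  rw [hF.isExtreme.extremePoints_eq] at h
  exact ((hfin.isCompact_convexHull ℝ).isClosed.closure_eq).symm.trans h

theorem IsPolytope.convexHull_vertices {P : Set E} (hP : IsPolytope P) :
    convexHull ℝ (vertices P) = P := by
  have := hP.convexHull_inter_vertices (IsExposed.refl P)
  rwa [Set.inter_eq_right.2 (show vertices P ⊆ P from extremePoints_subset)] at this

end Polytope

/-! ### From polytopes to spanning point sets -/

section Transfer

variable {E : Type*} [NormedAddCommGroup E] [NormedSpace ℝ E]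

theorem vectorSpan_image_linearMap {V : Type*} [AddCommGroup V] [Module ℝ V] (f : E →ₗ[ℝ] V)
    (X : Set E) : vectorSpan ℝ (f '' X) = (vectorSpan ℝ X).map f :=
  (AffineMap.map_vectorSpan f.toAffineMap).symm

theorem IsTwoLevel.finite_and_card_le [FiniteDimensional ℝ E] {P : Set E} {d : ℕ} (hP : IsPolytope P) (hd : HasDim P d)
    (h2 : IsTwoLevel P) :
    (vertices P).Finite ∧ (facets P).Finite ∧
      (vertices P).ncard * (facets P).ncard ≤ d * 2 ^ (d + 1) := by
  classical
  have hfin := hP.finite_vertices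
  refine ⟨hfin, ?_⟩
  rcases d with _ | d
  · have : facets P = ∅ := by
      ext F
      simp only [Set.mem_empty_iff_false, iff_false]
      rintro ⟨-, k, hk, -⟩
      have := hk.2.symm.trans hd.2
      omega
    simp [this]
  set V := vectorSpan ℝ P with hV
  have hdim : finrank ℝ V = d + 1 := hd.2
  -- A linear projection onto the direction space of `P` preserves differences of points of `P`. It
  -- makes the vertices affinely spanning and extends functionals on `V` to the ambient space.
  obtain ⟨π, hπ⟩ := LinearMap.exists_leftInverse_of_injective V.subtype V.ker_subtype
  have hπV : ∀ w : V, π w = w := fun w => LinearMap.congr_fun hπ w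
  have hπsub : ∀ x ∈ P, ∀ y ∈ P, ((π x - π y : V) : E) = x - y := fun x hx y hy => by
    have hmem : x - y ∈ V := vsub_mem_vectorSpan ℝ hx hy
    rw [← map_sub]
    exact congrArg Subtype.val (hπV ⟨x - y, hmem⟩)
  have hπinj : Set.InjOn π P := fun x hx y hy h => by
    have := hπsub x hx y hy
    rw [h, sub_self, Submodule.coe_zero] at this
    exact (sub_eq_zero.1 this.symm)
  have hfinrank : ∀ X ⊆ P, finrank ℝ (vectorSpan ℝ (π '' X)) = finrank ℝ (vectorSpan ℝ X) := by
    intro X hX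
    have hXV : vectorSpan ℝ X ≤ V := vectorSpan_mono ℝ hX
    rw [vectorSpan_image_linearMap, ← LinearMap.range_domRestrict]
    refine LinearMap.finrank_range_of_inj ?_
    rw [← LinearMap.ker_eq_bot, LinearMap.ker_eq_bot']
    rintro ⟨w, hw⟩ h
    have hw0 : (⟨w, hXV hw⟩ : V) = 0 := (hπV ⟨w, hXV hw⟩).symm.trans h
    exact Subtype.ext (congrArg (fun x : V => (x : E)) hw0)
  set vs := hfin.toFinset with hvs
  have hvP : ∀ v ∈ vertices P, v ∈ P := fun v hv => extremePoints_subset hv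
  set A := vs.image π with hA
  have hAspan : vectorSpan ℝ (A : Set V) = ⊤ := by
    rw [hA, Finset.coe_image, hvs, hfin.coe_toFinset]
    apply Submodule.eq_top_of_finrank_eq
    rw [hfinrank _ hvP, ← vectorSpan_convexHull, hP.convexHull_vertices]
  have hmemA : ∀ {a}, a ∈ A ↔ ∃ v ∈ vertices P, π v = a := by simp [hA, hvs]
  have hAne : A.Nonempty := by
    obtain ⟨v, hv⟩ : (vertices P).Nonempty := by
      rw [← convexHull_nonempty_iff (𝕜 := ℝ), hP.convexHull_vertices]
      exact hd.1
    exact ⟨_, hmemA.2 ⟨v, hv, rfl⟩⟩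
  have hAcard : A.card = (vertices P).ncard := by
    rw [hA, Finset.card_image_of_injOn, Set.ncard_eq_toFinset_card _ hfin]
    exact hπinj.mono fun v hv => hvP v (by simpa [hvs] using hv)
  have hA2 : ∀ c a₁, IsFacetFunctional A c a₁ → ∃ m' : ℝ, ∀ a ∈ A, c a = c a₁ ∨ c a = m' := by
    rintro c a₁ ⟨ha₁, hc0, hmin, hker⟩
    obtain ⟨v₁, hv₁, rfl⟩ := hmemA.1 ha₁
    set l : StrongDual ℝ E := LinearMap.toContinuousLinearMap (c ∘ₗ π) with hl
    have hlc : ∀ x, l x = c (π x) := fun x => rfl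
    have hl0 : l ≠ 0 := fun h => hc0 (LinearMap.ext fun w => by
      have := hlc w
      rw [h, hπV] at this
      exact this.symm)
    have hlmin : ∀ x ∈ P, l v₁ ≤ l x := by
      have : P ⊆ {x | l v₁ ≤ l x} := by
        rw [← hP.convexHull_vertices]
        refine convexHull_min (fun v hv => hmin _ (hmemA.2 ⟨v, hv, rfl⟩)) ?_
        exact convex_halfSpace_ge l.isLinear _
      exact this
    have hexp : IsExposed ℝ P (P ∩ {x | l x = l v₁}) := by
      refine fun _ => ⟨-l, ?_⟩
      ext x
      simp only [Set.mem_inter_iff, Set.mem_ofPred_eq, neg_apply, neg_le_neg_iff]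
      refine and_congr_right fun hx => ⟨fun h y hy => h ▸ hlmin y hy, fun h => ?_⟩
      exact le_antisymm (h v₁ (hvP _ hv₁)) (hlmin x hx)
    have hfacet : IsFacet P (P ∩ {x | l x = l v₁}) := by
      refine ⟨hexp, d, hd, ⟨v₁, hvP _ hv₁, rfl⟩, ?_⟩
      rw [← hP.convexHull_inter_vertices hexp, vectorSpan_convexHull,
        ← hfinrank _ fun x hx => hvP x hx.2]
      have himg : π '' (P ∩ {x | l x = l v₁} ∩ vertices P) =
          {a ∈ (A : Set V) | c a = c (π v₁)} := by
        ext a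
        simp only [Set.mem_image, Set.mem_inter_iff, Set.mem_ofPred_eq, Finset.mem_coe, hmemA, hlc]
        constructor
        · rintro ⟨v, ⟨⟨-, h⟩, hv⟩, rfl⟩; exact ⟨⟨v, hv, rfl⟩, h⟩
        · rintro ⟨⟨v, hv, rfl⟩, h⟩; exact ⟨v, ⟨⟨hvP v hv, h⟩, hv⟩, rfl⟩
      rw [himg, hker]
      have := Dual.finrank_ker_add_one_of_ne_zero hc0
      omega
    obtain ⟨m', hm'⟩ := h2 l (l v₁) hl0 hfacet
    refine ⟨m', fun a ha => ?_⟩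
    obtain ⟨v, hv, rfl⟩ := hmemA.1 ha
    exact hm' hv
  set 𝓕 := A.powerset.filter (· ∈ facetSets A) with h𝓕def
  have h𝓕 : ∀ S, S ∈ 𝓕 ↔ S ∈ facetSets A := fun S => by
    rw [h𝓕def, Finset.mem_filter, Finset.mem_powerset, and_iff_right_iff_imp]
    rintro ⟨c, a₁, -, rfl⟩
    exact Finset.filter_subset _ _
  have hmain := card_mul_card_facetSets_le hd.2 hAne hAspan hA2 h𝓕
  set g : Set E → Finset V := fun F => (vs.filter (· ∈ F)).image π with hg
  have hmaps : ∀ F ∈ facets P, g F ∈ 𝓕 := by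
    rintro F ⟨hexp, k, hk, hF⟩
    obtain rfl : k = d := by
      have := hk.2.symm.trans hd.2
      omega
    have hFP := hexp.subset
    have hFv := hP.convexHull_inter_vertices hexp
    obtain ⟨v₁, hv₁F, hv₁⟩ : (F ∩ vertices P).Nonempty := by
      rw [← convexHull_nonempty_iff (𝕜 := ℝ), hFv]
      exact hF.1
    obtain ⟨l, hl⟩ := hexp hF.1
    have hmax : ∀ y ∈ P, l y ≤ l v₁ := by
      rw [hl] at hv₁F
      exact hv₁F.2
    have hFiff : ∀ x ∈ P, x ∈ F ↔ l x = l v₁ := fun x hx => by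
      rw [hl]
      refine ⟨fun h => le_antisymm (hmax x hx) (h.2 v₁ (hvP _ hv₁)), fun h => ⟨hx, fun y hy => ?_⟩⟩
      rw [h]; exact hmax y hy
    -- Exposed faces maximise `l`, facet functionals are minimised; hence the sign.
    set c : Dual ℝ V := -((l : E →ₗ[ℝ] ℝ) ∘ₗ V.subtype) with hc
    have hcl : ∀ x ∈ P, c (π x) - c (π v₁) = l v₁ - l x := fun x hx => by
      rw [← map_sub]
      simp only [hc, LinearMap.neg_apply, LinearMap.comp_apply, Submodule.subtype_apply,
        hπsub x hx v₁ (hvP _ hv₁)]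
      simp
    have hc0 : c ≠ 0 := fun h => by
      have hFeq : F = P := hFP.antisymm fun x hx => (hFiff x hx).2 (by
        have := hcl x hx
        rw [h] at this
        simp only [LinearMap.zero_apply, sub_self] at this
        linarith)
      have h1 := hF.2
      have h2 := hd.2
      rw [hFeq] at h1
      omega
    have hset : {a ∈ (A : Set V) | c a = c (π v₁)} = π '' (F ∩ vertices P) := by
      ext a
      simp only [Set.mem_image, Set.mem_inter_iff, Set.mem_ofPred_eq, Finset.mem_coe, hmemA]
      constructor
      · rintro ⟨⟨v, hv, rfl⟩, h⟩
        refine ⟨v, ⟨(hFiff v (hvP v hv)).2 ?_, hv⟩, rfl⟩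
        linarith [hcl v (hvP v hv)]
      · rintro ⟨v, ⟨hvF, hv⟩, rfl⟩
        refine ⟨⟨v, hv, rfl⟩, ?_⟩
        linarith [hcl v (hvP v hv), (hFiff v (hvP v hv)).1 hvF]
    rw [h𝓕]
    refine ⟨c, π v₁, ⟨hmemA.2 ⟨v₁, hv₁, rfl⟩, hc0, ?_, ?_⟩, ?_⟩
    · intro a ha
      obtain ⟨v, hv, rfl⟩ := hmemA.1 ha
      linarith [hcl v (hvP v hv), hmax v (hvP v hv)]
    · apply Submodule.eq_of_le_of_finrank_eq
      · exact vectorSpan_le_ker_iff.2 fun x hx y hy => hx.2.trans hy.2.symm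
      · rw [hset, hfinrank _ fun x hx => hvP x hx.2, ← vectorSpan_convexHull, hFv, hF.2]
        have := Dual.finrank_ker_add_one_of_ne_zero hc0
        omega
    · rw [← Finset.coe_inj]
      have : (({a ∈ A | c a = c (π v₁)} : Finset V) : Set V) =
        {a ∈ (A : Set V) | c a = c (π v₁)} := by ext; simp
      rw [this, hset]
      ext a
      simp [hg, hvs, and_comm]
  have hginj : Set.InjOn g (facets P) := by
    have hmem : ∀ F, ∀ v ∈ vertices P, π v ∈ g F ↔ v ∈ F := fun F v hv => by
      simp only [hg, Finset.mem_image, Finset.mem_filter, hvs, hfin.mem_toFinset]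
      constructor
      · rintro ⟨w, ⟨hw, hwF⟩, h⟩
        rwa [← hπinj (hvP w hw) (hvP v hv) h]
      · exact fun h => ⟨v, ⟨hv, h⟩, rfl⟩
    intro F hF F' hF' h
    rw [← hP.convexHull_inter_vertices hF.1, ← hP.convexHull_inter_vertices hF'.1]
    congr 1
    ext v
    simp only [Set.mem_inter_iff]
    refine and_congr_left fun hv => ?_
    rw [← hmem F v hv, ← hmem F' v hv, h]
  have hfacfin : (facets P).Finite :=
    Set.Finite.of_injOn (fun F hF => Finset.mem_coe.2 (hmaps F hF)) hginj 𝓕.finite_toSet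
  refine ⟨hfacfin, ?_⟩
  have hle : (facets P).ncard ≤ 𝓕.card := by
    rw [← Set.ncard_coe_finset]
    exact Set.ncard_le_ncard_of_injOn g (fun F hF => Finset.mem_coe.2 (hmaps F hF)) hginj
      𝓕.finite_toSet
  rw [← hAcard]
  exact (Nat.mul_le_mul_left _ hle).trans hmain

end Transfer

/-! ### The cube attains the bound -/

section Cube

theorem cube_eq_image (d : ℕ) :
    cube d = (WithLp.linearEquiv 2 ℝ (Fin d → ℝ)).symm '' Set.univ.pi fun _ => Set.Icc (0 : ℝ) 1 := by
  ext x
  rw [LinearEquiv.image_symm_eq_preimage]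
  simp [cube, Pi.le_def, forall_and]

theorem vertices_cube (d : ℕ) : vertices (cube d) = {x | ∀ i, x i = 0 ∨ x i = 1} := by
  rw [vertices, cube_eq_image, ← image_extremePoints, extremePoints_pi,
    LinearEquiv.image_symm_eq_preimage]
  ext x
  simp

theorem isPolytope_cube (d : ℕ) : IsPolytope (cube d) := by
  have hfin : (Set.univ.pi fun _ : Fin d => ({0, 1} : Set ℝ)).Finite :=
    Set.Finite.pi fun _ => Set.toFinite _
  refine ⟨(hfin.image (WithLp.linearEquiv 2 ℝ (Fin d → ℝ)).symm).toFinset, ?_⟩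
  rw [Set.Finite.coe_toFinset, cube_eq_image]
  have := (WithLp.linearEquiv 2 ℝ (Fin d → ℝ)).symm.toLinearMap.image_convexHull
    (Set.univ.pi fun _ : Fin d => ({0, 1} : Set ℝ))
  rw [convexHull_pi] at this
  simpa [convexHull_pair, segment_eq_Icc] using this

variable {d : ℕ}

theorem single_mem_cube (i : Fin d) {t : ℝ} (ht : t ∈ Set.Icc (0 : ℝ) 1) :
    EuclideanSpace.single i t ∈ cube d := by
  intro j
  rw [PiLp.single_apply]
  split_ifs
  · exact ht
  · simp

theorem hasDim_cube (d : ℕ) : HasDim (cube d) d := by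
  have h0 : (0 : EuclideanSpace ℝ (Fin d)) ∈ cube d := fun i => by simp
  refine ⟨⟨0, h0⟩, ?_⟩
  have htop : vectorSpan ℝ (cube d) = ⊤ := by
    rw [eq_top_iff, ← (EuclideanSpace.basisFun (Fin d) ℝ).toBasis.span_eq, Submodule.span_le]
    rintro _ ⟨i, rfl⟩
    have := vsub_mem_vectorSpan ℝ (single_mem_cube i (t := 1) (by simp)) h0
    simpa using this
  rw [htop, finrank_top, finrank_euclideanSpace_fin]

theorem vectorSpan_cube_inter (i : Fin d) {t : ℝ} (ht : t ∈ Set.Icc (0 : ℝ) 1) :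
    vectorSpan ℝ (cube d ∩ {x | x i = t}) =
      LinearMap.ker ((EuclideanSpace.proj i : StrongDual ℝ (EuclideanSpace ℝ (Fin d))) :
        Dual ℝ (EuclideanSpace ℝ (Fin d))) := by
  apply le_antisymm
  · rw [vectorSpan_le_ker_iff]
    intro x hx y hy
    exact (hx.2 : x i = t).trans (hy.2 : y i = t).symm
  · intro x hx
    have hxi : x i = 0 := hx
    rw [← (EuclideanSpace.basisFun (Fin d) ℝ).sum_repr x]
    refine Submodule.sum_mem _ fun j _ => ?_
    by_cases hji : j = i
    · subst hji
      simp [hxi]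
    · refine Submodule.smul_mem _ _ ?_
      have h1 : EuclideanSpace.single i t ∈ cube d ∩ {x | x i = t} :=
        ⟨single_mem_cube i ht, by simp⟩
      have h2 : EuclideanSpace.single j 1 + EuclideanSpace.single i t ∈ cube d ∩ {x | x i = t} := by
        refine ⟨fun k => ?_, by simp [Ne.symm hji]⟩
        simp only [PiLp.add_apply, PiLp.single_apply]
        by_cases hk : k = j
        · subst hk; simp [hji]
        · rw [if_neg hk, zero_add]
          split_ifs
          · exact ht
          · simp
      have := vsub_mem_vectorSpan ℝ h2 h1
      simpa using this

theorem finrank_ker_proj (i : Fin d) :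
    finrank ℝ (LinearMap.ker ((EuclideanSpace.proj i : StrongDual ℝ (EuclideanSpace ℝ (Fin d))) :
        Dual ℝ (EuclideanSpace ℝ (Fin d)))) + 1 = d := by
  rw [Dual.finrank_ker_add_one_of_ne_zero, finrank_euclideanSpace_fin]
  intro h
  have := congrArg (fun f : Dual ℝ (EuclideanSpace ℝ (Fin d)) => f (EuclideanSpace.single i 1)) h
  simp at this

theorem isFacet_cube_inter (i : Fin d) {t : ℝ} (ht : t = 0 ∨ t = 1) :
    IsFacet (cube d) (cube d ∩ {x | x i = t}) := by
  have htI : t ∈ Set.Icc (0 : ℝ) 1 := by rcases ht with rfl | rfl <;> simp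
  have hne : EuclideanSpace.single i t ∈ cube d ∩ {x | x i = t} :=
    ⟨single_mem_cube i htI, by simp⟩
  have hk := finrank_ker_proj i
  have hproj : ∀ y : EuclideanSpace ℝ (Fin d),
      (EuclideanSpace.proj i : StrongDual ℝ (EuclideanSpace ℝ (Fin d))) y = y i := fun _ => rfl
  refine ⟨fun _ => ?_, d - 1, ?_, ⟨_, hne⟩, ?_⟩
  · rcases ht with rfl | rfl
    · refine ⟨-EuclideanSpace.proj i, ?_⟩
      ext x
      simp only [Set.mem_inter_iff, Set.mem_ofPred_eq, neg_apply, neg_le_neg_iff,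
        hproj]
      refine and_congr_right fun hx => ⟨fun h y hy => h ▸ (hy i).1, fun h => ?_⟩
      exact le_antisymm ((h _ hne.1).trans hne.2.le) (hx i).1
    · refine ⟨EuclideanSpace.proj i, ?_⟩
      ext x
      simp only [Set.mem_inter_iff, Set.mem_ofPred_eq, hproj]
      refine and_congr_right fun hx => ⟨fun h y hy => h ▸ (hy i).2, fun h => ?_⟩
      exact le_antisymm (hx i).2 (hne.2.symm.le.trans (h _ hne.1))
  · rw [← hk, Nat.add_sub_cancel, hk]
    exact hasDim_cube d
  · rw [vectorSpan_cube_inter i htI]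
    omega

/-- A functional exposing the facet has a nonzero coordinate `i`, which pins `x i` to `0` or `1` on
the facet. By dimension the facet spans the hyperplane direction `x i = 0`, so `l` is a multiple of
the `i`-th coordinate. -/
theorem isTwoLevel_cube (d : ℕ) : IsTwoLevel (cube d) := by
  rintro l c hl ⟨hexp, k, hk, hF⟩
  obtain ⟨x₀, hx₀⟩ := hF.1
  obtain ⟨f, hf⟩ := hexp hF.1
  set F := cube d ∩ {x | l x = c} with hFdef
  have hkd : k + 1 = d := hk.2.symm.trans (hasDim_cube d).2
  obtain ⟨i, hi⟩ : ∃ i, f (EuclideanSpace.single i 1) ≠ 0 := by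
    by_contra! hcon
    have hf0 : ∀ x, f x = 0 := fun x => by
      rw [← (EuclideanSpace.basisFun (Fin d) ℝ).sum_repr x, map_sum]
      refine Finset.sum_eq_zero fun j _ => ?_
      rw [map_smul, EuclideanSpace.basisFun_apply, hcon, smul_zero]
    have hFc : F = cube d := by
      rw [hf]
      ext x
      simp [hf0]
    have h1 := hF.2
    have h2 := hk.2
    rw [hFc] at h1
    omega
  obtain ⟨ε, hε, hFε⟩ : ∃ ε : ℝ, (ε = 0 ∨ ε = 1) ∧ ∀ x ∈ F, x i = ε := by
    -- Changing the `i`-th coordinate of `x` to `ε` stays in the cube and cannot increase `f`.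
    have hstep : ∀ x ∈ F, ∀ ε ∈ Set.Icc (0 : ℝ) 1, (ε - x i) * f (EuclideanSpace.single i 1) ≤ 0 := by
      intro x hx ε hε
      rw [hf] at hx
      have hy : x + (ε - x i) • EuclideanSpace.single i 1 ∈ cube d := fun j => by
        simp only [PiLp.add_apply, PiLp.smul_apply, PiLp.single_apply, smul_eq_mul]
        split_ifs with hj
        · subst hj; simpa using hε
        · simpa using hx.1 j
      have := hx.2 _ hy
      rw [map_add, map_smul, smul_eq_mul] at this
      linarith
    rcases lt_or_gt_of_ne hi with h | h
    · refine ⟨0, .inl rfl, fun x hx => ?_⟩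
      have h1 := hstep x hx 0 (by simp)
      have h2 := (hx.1 i).1
      nlinarith
    · refine ⟨1, .inr rfl, fun x hx => ?_⟩
      have h1 := hstep x hx 1 (by simp)
      have h2 := (hx.1 i).2
      nlinarith
  have hle : vectorSpan ℝ F ≤ LinearMap.ker
      ((EuclideanSpace.proj i : StrongDual ℝ (EuclideanSpace ℝ (Fin d))) :
        Dual ℝ (EuclideanSpace ℝ (Fin d))) :=
    vectorSpan_le_ker_iff.2 fun x hx y hy => (hFε x hx).trans (hFε y hy).symm
  have heq := Submodule.eq_of_le_of_finrank_eq hle (by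
    have := finrank_ker_proj i
    rw [hF.2]
    omega)
  have hle' : vectorSpan ℝ F ≤ LinearMap.ker (l : Dual ℝ (EuclideanSpace ℝ (Fin d))) :=
    vectorSpan_le_ker_iff.2 fun x hx y hy => (hx.2 : l x = c).trans (hy.2 : l y = c).symm
  rw [heq] at hle'
  obtain ⟨t, ht⟩ := exists_eq_smul_of_ker_le hle'
  have hlt : ∀ x, l x = t * x i := fun x =>
    congrArg (fun g : Dual ℝ (EuclideanSpace ℝ (Fin d)) => g x) ht
  have hc : c = t * ε := by
    rw [← hFε x₀ hx₀, ← hlt]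
    exact (hx₀.2 : l x₀ = c).symm
  refine ⟨t * (1 - ε), fun v hv => ?_⟩
  rw [vertices_cube] at hv
  simp only [Set.mem_union, Set.mem_ofPred_eq, hlt, hc]
  rcases hε with rfl | rfl <;> rcases hv i with h | h <;> simp [h]

theorem card_le_ncard_of_injective {ι α : Type*} [Fintype ι] {s : Set α} (hs : s.Finite)
    {f : ι → α} (hf : Function.Injective f) (hfs : ∀ i, f i ∈ s) : Fintype.card ι ≤ s.ncard := by
  rw [← Nat.card_eq_fintype_card, ← Set.ncard_univ]
  exact Set.ncard_le_ncard_of_injOn f (fun i _ => hfs i) hf.injOn hs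

theorem two_pow_le_ncard_vertices_cube (d : ℕ) : 2 ^ d ≤ (vertices (cube d)).ncard := by
  have := card_le_ncard_of_injective (isPolytope_cube d).finite_vertices
    (f := fun s : Fin d → Bool => WithLp.toLp 2 fun i => if s i then (1 : ℝ) else 0) ?_ ?_
  · simpa using this
  · intro s s' h
    funext i
    have := congrArg (fun x : EuclideanSpace ℝ (Fin d) => x i) h
    by_cases h1 : s i <;> by_cases h2 : s' i <;> simp_all
  · intro s
    rw [vertices_cube]
    intro i
    by_cases h : s i <;> simp [h]

theorem two_mul_le_ncard_facets_cube (hfin : (facets (cube d)).Finite) :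
    d * 2 ≤ (facets (cube d)).ncard := by
  have := card_le_ncard_of_injective hfin
    (f := fun p : Fin d × Bool => cube d ∩ {x | x p.1 = if p.2 then 1 else 0}) ?_ ?_
  · simpa using this
  · rintro ⟨i, s⟩ ⟨j, s'⟩ h
    -- Two test points of one facet, with all coordinates other than `i` equal to `0` and to `1`
    -- respectively, so no other coordinate is constant on it.
    have h2 : (EuclideanSpace.single i (if s then 1 else 0) : EuclideanSpace ℝ (Fin d)) ∈
        cube d ∩ {x | x i = if s then 1 else 0} :=
      ⟨single_mem_cube i (by cases s <;> simp), by simp⟩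
    have h3 : (WithLp.toLp 2 (Function.update (fun _ => 1) i (if s then 1 else 0)) :
        EuclideanSpace ℝ (Fin d)) ∈ cube d ∩ {x | x i = if s then 1 else 0} :=
      ⟨fun m => by by_cases hm : m = i <;> cases s <;> simp [hm], by simp⟩
    simp only at h
    rw [h] at h2 h3
    have h2' := h2.2
    have h3' := h3.2
    by_cases hij : i = j
    · subst hij
      cases s <;> cases s' <;> simp_all
    · have hji : j ≠ i := Ne.symm hij
      simp only [Set.mem_ofPred_eq, PiLp.single_apply, if_neg hji] at h2'
      simp only [Set.mem_ofPred_eq, Function.update_of_ne hji] at h3'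
      rw [← h3'] at h2'
      norm_num at h2'
  · rintro ⟨i, s⟩
    exact isFacet_cube_inter i (by cases s <;> simp)

end Cube

end TwoLevel

theorem theorem2 (d : ℕ) :
    (∀ (n : ℕ) (P : Set (EuclideanSpace ℝ (Fin n))),
      TwoLevel.IsPolytope P → TwoLevel.HasDim P d → TwoLevel.IsTwoLevel P →
        (TwoLevel.vertices P).Finite ∧ (TwoLevel.facets P).Finite ∧
          (TwoLevel.vertices P).ncard * (TwoLevel.facets P).ncard ≤ d * 2 ^ (d + 1)) ∧
    (TwoLevel.IsPolytope (TwoLevel.cube d) ∧ TwoLevel.HasDim (TwoLevel.cube d) d ∧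
      TwoLevel.IsTwoLevel (TwoLevel.cube d) ∧
        (TwoLevel.vertices (TwoLevel.cube d)).ncard * (TwoLevel.facets (TwoLevel.cube d)).ncard
          = d * 2 ^ (d + 1)) := by
  refine ⟨fun n P hP hd h2 => h2.finite_and_card_le hP hd, TwoLevel.isPolytope_cube d,
    TwoLevel.hasDim_cube d, TwoLevel.isTwoLevel_cube d, ?_⟩
  obtain ⟨-, hfac, hle⟩ := (TwoLevel.isTwoLevel_cube d).finite_and_card_le
    (TwoLevel.isPolytope_cube d) (TwoLevel.hasDim_cube d)
  refine le_antisymm hle ?_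
  calc d * 2 ^ (d + 1) = 2 ^ d * (d * 2) := by ring
    _ ≤ _ := Nat.mul_le_mul (TwoLevel.two_pow_le_ncard_vertices_cube d)
      (TwoLevel.two_mul_le_ncard_facets_cube hfac)
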